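/- Let $\Omega\subset\mathbb R^n$ ($n\ge 1$) be a bounded Lipschitz domain and let $\mathcal M$ be a smooth hypersurface which divides $\Omega$ into two Lipschitz subdomains, $\Omega\setminus\mathcal M=\Omega_+\cup\Omega_-$ with $\Omega_+\cap\Omega_-=\emptyset$. The measure $\mu$ is the $(n-1)$-dimensional surface measure on $\mathcal M\cap\Omega$, $L^2(\mathcal M)$ and $\|\cdot\|_{\mathcal M}$ refer to it, and $\|\cdot\|_A$ is the norm of $L^2(A)$. Let $\varphi\in H^1(\Omega)$ (an extension of a boundary datum in $H^{1/2}(\partial\Omega)$), let $\psi$ be continuous (for instance smooth) on $\mathcal M\cap\Omega$, and let $$\mathbb K=\{v\in \varphi+H^1_0(\Omega):\ v\ge\psi\ \text{a.e. on }\mathcal M\cap\Omega\},$$ where values of $v$ on $\mathcal M$ are understood as traces in $L^2(\mathcal M)$. Let $u\in\mathbb K$ be a minimizer over $\mathbb K$ of $J(v)=\frac12\int_\Omega|\nabla v|^2dx$. Put $\Lambda=\{\lambda\in L^2(\mathcal M):\lambda\ge0 \text{ a.e. on }\mathcal M\}$ and $$H(\Omega_\pm,\mathrm{div})=\{q^*\in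 L^2(\Omega,\mathbb R^n):\ \mathrm{div}(q^*|_{\Omega_\pm})\in L^2(\Omega_\pm),\ [q^*\cdot\mathbf n]\in L^2(\mathcal M)\},$$ where $\mathrm{div}$ is the weak divergence and $[q^*\cdot\mathbf n]$ is the jump across $\mathcal M$ of the normal component (the sum of the two outward normal components), characterized by $\int_\Omega q^*\cdot\nabla w\,dx+\int_{\Omega_+}w\,\mathrm{div}\,q^*dx+\int_{\Omega_-}w\,\mathrm{div}\,q^*dx=\int_{\mathcal M}[q^*\cdot\mathbf n]\,w\,d\mu$ for all $w\in C_c^\infty(\Omega)$. Let $C_{F_{\Omega_+}},C_{F_{\Omega_-}},C_{Tr_{\mathcal M}}(\Omega_+),C_{Tr_{\mathcal M}}(\Omega_-)\ge 0$ be any constants such that for all $w\in H^1_0(\Omega)$ $$\|w\|_{\Omega_\pm}\le C_{F_{\Omega_\pm}}\|\nabla w\|_{\Omega_\pm},\qquad \|w\|_{\mathcal M}\le C_{Tr_{\mathcal M}}(\Omega_\pm)\|\nabla w\|_{\Omega_\pm},$$ and put $C_{Tr_{\mathcal M}}=\min\{C_{Tr_{\mathcal M}}(\Omega_+),C_{Tr_{\mathcal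 M}}(\Omega_-)\}$. Then for all $v\in\mathbb K$, $\beta_1>0$, $\beta_2>0$, $q^*\in H(\Omega_\pm,\mathrm{div})$ and $\lambda\in\Lambda$, $$\|\nabla(v-u)\|_\Omega^2\le \mathfrak M_1(v,q^*,\beta_1,\beta_2)+\mathfrak M_2(v,q^*,\beta_1,\beta_2,\lambda,\psi),$$ where $$\mathfrak M_1=(1+\beta_1)\|\nabla v-q^*\|_\Omega^2+(1+\beta_1^{-1})(1+\beta_2)\big[C_{F_{\Omega_+}}\|\mathrm{div}\,q^*\|_{\Omega_+}+C_{F_{\Omega_-}}\|\mathrm{div}\,q^*\|_{\Omega_-}\big]^2,$$ $$\mathfrak M_2=(1+\beta_1^{-1})(1+\beta_2^{-1})\,C_{Tr_{\mathcal M}}^2\,\|\lambda-[q^*\cdot\mathbf n]\|_{\mathcal M}^2+2\int_{\mathcal M}\lambda(v-\psi)\,d\mu,$$ the last integral, whose integrand is nonnegative a.e., being taken in $[0,\infty]$. -/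

import Mathlib

open MeasureTheory Filter Topology
open scoped ENNReal NNReal ContDiff

noncomputable section

namespace ThinObstacle

/-- The ambient Euclidean space of dimension `n = d + 1`, so that hypersurfaces have
dimension `d = n - 1`. -/
abbrev Sp (d : ℕ) : Type := EuclideanSpace ℝ (Fin (d + 1))

variable {d : ℕ}

/-! ### Geometry -/

/-- A Lipschitz domain: nonempty, open, connected, bounded, and near each boundary point,
in suitable Cartesian coordinates (the last axis being the unit vector `ν`), the set of points
strictly above the graph of a Lipschitz function `γ` of the coordinates orthogonal to `ν`. -/
structure IsLipschitzDomain (Ω : Set (Sp d)) : Prop where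
  isOpen : IsOpen Ω
  isConnected : IsConnected Ω
  isBounded : Bornology.IsBounded Ω
  boundary : ∀ x ∈ frontier Ω, ∃ (ν : Sp d) (γ : Sp d → ℝ) (L : ℝ≥0) (r : ℝ),
    ‖ν‖ = 1 ∧ LipschitzWith L γ ∧ 0 < r ∧
      Ω ∩ Metric.ball x r =
        {y | γ (y - inner ℝ ν y • ν) < inner ℝ ν y} ∩ Metric.ball x r

/-- Inside `Ω`, the set `M` is a smooth embedded hypersurface: near each point of `M ∩ Ω` it is
the zero set of a smooth function with nonvanishing gradient. -/
def IsSmoothHypersurfaceIn (M Ω : Set (Sp d)) : Prop :=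
  ∀ x ∈ M ∩ Ω, ∃ (U : Set (Sp d)) (f : Sp d → ℝ),
    IsOpen U ∧ x ∈ U ∧ ContDiffOn ℝ ∞ f U ∧ gradient f x ≠ 0 ∧ M ∩ U = {y ∈ U | f y = 0}

/-- `Ω` is a bounded Lipschitz domain which the smooth hypersurface `M` divides into the two
Lipschitz subdomains `Ωp` and `Ωm`. -/
structure IsDivided (Ω Ωp Ωm M : Set (Sp d)) : Prop where
  domain : IsLipschitzDomain Ω
  domain_plus : IsLipschitzDomain Ωp
  domain_minus : IsLipschitzDomain Ωm
  hypersurface : IsSmoothHypersurfaceIn M Ω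
  disjoint : Disjoint Ωp Ωm
  union_eq : Ωp ∪ Ωm = Ω \ M

/-- The `(n-1)`-dimensional surface measure on `M ∩ Ω`. -/
def surf (Ω M : Set (Sp d)) : Measure (Sp d) :=
  (Measure.euclideanHausdorffMeasure d).restrict (M ∩ Ω)

/-- The norm of `L²(A)`, for scalar or vector valued functions. -/
def nrm {F : Type*} [NormedAddCommGroup F] (A : Set (Sp d)) (f : Sp d → F) : ℝ≥0∞ :=
  eLpNorm f 2 (volume.restrict A)

/-- The norm of `L²(M)`. -/
def nrmM (Ω M : Set (Sp d)) (f : Sp d → ℝ) : ℝ≥0∞ := eLpNorm f 2 (surf Ω M)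

/-! ### Function spaces -/

/-- `φ ∈ C_c^∞(A)`. -/
def IsTest (A : Set (Sp d)) (φ : Sp d → ℝ) : Prop :=
  ContDiff ℝ ∞ φ ∧ HasCompactSupport φ ∧ tsupport φ ⊆ A

/-- An element of `H¹(Ω)`: a square integrable function (values outside `Ω` are irrelevant)
together with its square integrable weak gradient, which is unique up to null sets. -/
structure H1 (Ω : Set (Sp d)) where
  toFun : Sp d → ℝ
  grad : Sp d → Sp d
  memLp_toFun : MemLp toFun 2 (volume.restrict Ω)
  memLp_grad : MemLp grad 2 (volume.restrict Ω)
  weak_grad : ∀ φ, IsTest Ω φ →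
    ∫ x in Ω, toFun x • gradient φ x = - ∫ x in Ω, φ x • grad x

/-- Convergence of a sequence of smooth functions to `w` in `H¹(Ω)`. -/
def TendstoH1 {Ω : Set (Sp d)} (f : ℕ → Sp d → ℝ) (w : H1 Ω) : Prop :=
  Tendsto (fun k => nrm Ω (fun x => f k x - w.toFun x)) atTop (𝓝 0) ∧
  Tendsto (fun k => nrm Ω (fun x => gradient (f k) x - w.grad x)) atTop (𝓝 0)

/-- `w ∈ H¹₀(Ω)`, the closure of `C_c^∞(Ω)` in `H¹(Ω)`. -/
def MemH10 {Ω : Set (Sp d)} (w : H1 Ω) : Prop :=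
  ∃ f : ℕ → Sp d → ℝ, (∀ k, IsTest Ω (f k)) ∧ TendstoH1 f w

/-- `g ∈ L²(M)` is the trace of `w ∈ H¹(Ω)` on `M`: for some sequence of functions smooth on the
closure of `Ω` which converges to `w` in `H¹(Ω)`, the restrictions to `M` converge to `g` in
`L²(M)`. -/
def IsTrace {Ω : Set (Sp d)} (M : Set (Sp d)) (w : H1 Ω) (g : Sp d → ℝ) : Prop :=
  MemLp g 2 (surf Ω M) ∧
  ∃ f : ℕ → Sp d → ℝ, (∀ k, IsTest Set.univ (f k)) ∧ TendstoH1 f w ∧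
    Tendsto (fun k => nrmM Ω M (fun x => f k x - g x)) atTop (𝓝 0)

/-- An element of `H(Ω_±, div)`: a square integrable field `toFun` on `Ω`, with a function `div`
whose restrictions to `Ωp` and `Ωm` are square integrable and are the weak divergences of the
field there, and with the jump `[q · n] = q · n₊ + q · n₋ ∈ L²(M)` of its normal component
(`n₊`, `n₋` outer normals to `Ωp`, `Ωm`). The jump is understood, as always for such fields, through
the Gauss-Green formula
`∫_Ω q · ∇φ + ∫_{Ωp} φ div q + ∫_{Ωm} φ div q = ∫_M [q · n] φ` for all `φ ∈ C_c^∞(Ω)`. -/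
structure HDiv (Ω Ωp Ωm M : Set (Sp d)) where
  toFun : Sp d → Sp d
  div : Sp d → ℝ
  jump : Sp d → ℝ
  memLp_toFun : MemLp toFun 2 (volume.restrict Ω)
  memLp_div_plus : MemLp div 2 (volume.restrict Ωp)
  memLp_div_minus : MemLp div 2 (volume.restrict Ωm)
  memLp_jump : MemLp jump 2 (surf Ω M)
  weak_div_plus : ∀ φ, IsTest Ωp φ →
    ∫ x in Ωp, inner ℝ (toFun x) (gradient φ x) = - ∫ x in Ωp, div x * φ x
  weak_div_minus : ∀ φ, IsTest Ωm φ →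
    ∫ x in Ωm, inner ℝ (toFun x) (gradient φ x) = - ∫ x in Ωm, div x * φ x
  weak_jump : ∀ φ, IsTest Ω φ →
    (∫ x in Ω, inner ℝ (toFun x) (gradient φ x))
      + (∫ x in Ωp, div x * φ x) + (∫ x in Ωm, div x * φ x) = ∫ x, jump x * φ x ∂(surf Ω M)

/-- `λ ∈ Λ`: square integrable on `M` and nonnegative almost everywhere on `M`. -/
def MemLambda (Ω M : Set (Sp d)) (lam : Sp d → ℝ) : Prop :=
  MemLp lam 2 (surf Ω M) ∧ ∀ᵐ x ∂(surf Ω M), 0 ≤ lam x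

/-! ### The thin obstacle problem -/

/-- The energy `J(v) = ½ ∫_Ω |∇v|²`. -/
def energy {Ω : Set (Sp d)} (v : H1 Ω) : ℝ := (1 / 2) * ∫ x in Ω, ‖v.grad x‖ ^ 2

/-- The admissible set `𝕂`: the functions `v ∈ φ + H¹₀(Ω)`, i.e. `v ∈ H¹(Ω)` with `v = φ` on `∂Ω`,
with trace `≥ ψ` almost everywhere on `M ∩ Ω`. The boundary datum in `H^{1/2}(∂Ω)` is represented
by an extension `φ ∈ H¹(Ω)`. -/
def K {Ω : Set (Sp d)} (M : Set (Sp d)) (φ : H1 Ω) (ψ : Sp d → ℝ) : Set (H1 Ω) :=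
  {v | (∃ w : H1 Ω, MemH10 w ∧
          v.toFun =ᵐ[volume.restrict Ω] fun x => φ.toFun x + w.toFun x) ∧
       ∃ g, IsTrace M v g ∧ ∀ᵐ x ∂(surf Ω M), ψ x ≤ g x}

/-! ### Constants and majorants -/

/-- `C` is a constant in the Friedrichs inequality `‖w‖_A ≤ C ‖∇w‖_A` for `w ∈ H¹₀(Ω)`
(`A` one of the two subdomains). -/
def IsFriedrichsConst (Ω A : Set (Sp d)) (C : ℝ≥0) : Prop :=
  ∀ w : H1 Ω, MemH10 w → nrm A w.toFun ≤ C * nrm A w.grad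

/-- `C` is a constant in the trace inequality `‖w‖_M ≤ C ‖∇w‖_A` for `w ∈ H¹₀(Ω)`
(`A` one of the two subdomains). -/
def IsTraceConst (Ω M A : Set (Sp d)) (C : ℝ≥0) : Prop :=
  ∀ w : H1 Ω, MemH10 w → ∀ g, IsTrace M w g → nrmM Ω M g ≤ C * nrm A w.grad

/-- The majorant `𝔐₁`. -/
def majorant₁ {Ω Ωp Ωm M : Set (Sp d)} (CFp CFm : ℝ≥0) (v : H1 Ω) (q : HDiv Ω Ωp Ωm M)
    (β₁ β₂ : ℝ) : ℝ≥0∞ :=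
  ENNReal.ofReal (1 + β₁) * nrm Ω (fun x => v.grad x - q.toFun x) ^ 2
    + ENNReal.ofReal ((1 + β₁⁻¹) * (1 + β₂)) * (CFp * nrm Ωp q.div + CFm * nrm Ωm q.div) ^ 2

/-- The majorant `𝔐₂`; `vM` is the trace of `v` on `M`. The integrand `λ (v - ψ)` is nonnegative
for admissible `v`, and its integral is taken with values in `[0, ∞]`. -/
def majorant₂ {Ω Ωp Ωm M : Set (Sp d)} (CTr : ℝ≥0) (vM : Sp d → ℝ) (q : HDiv Ω Ωp Ωm M)
    (β₁ β₂ : ℝ) (lam ψ : Sp d → ℝ) : ℝ≥0∞ :=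
  ENNReal.ofReal ((1 + β₁⁻¹) * (1 + β₂⁻¹)) * (CTr : ℝ≥0∞) ^ 2
      * nrmM Ω M (fun x => lam x - q.jump x) ^ 2
    + 2 * ∫⁻ x, ENNReal.ofReal (lam x * (vM x - ψ x)) ∂(surf Ω M)

end ThinObstacle

end

noncomputable section

namespace ThinObstacle

variable {d : ℕ}
-- Put w = v - u, an element of H¹₀(Ω). Since 𝕂 is convex, minimality of u gives ∫ ∇u·∇w ≥ 0
-- (`integral_inner_grad_sub_nonneg`), so ‖∇w‖² ≤ ∫ (∇v - q)·∇w + ∫ q·∇w for every field q. The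
-- Gauss-Green formula, extended from test functions to H¹₀(Ω) by density
-- (`HDiv.integral_inner_grad`), turns the last integral into -∫ w div q over the two subdomains
-- plus ∫_M [q·n] w. Split [q·n] = λ - (λ - [q·n]); as λ ≥ 0 and u ≥ ψ on M, the λ part is at most I
-- = ∫_M λ(v - ψ). Cauchy-Schwarz with the Friedrichs and trace inequalities gives n² ≤ (a + D + T)
-- n + I for n = ‖∇w‖ (`grad_sub_sq_le`), and Young's inequality yields the majorants
-- (`sq_le_of_young`).
--
-- The geometric input is finiteness of the surface measure: it puts test functions in L²(M), which
-- all handling of traces relies on. It holds because M ∩ Ω lies in the Lipschitz boundaries of the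
-- subdomains.
/-! ### The surface measure is finite -/

/-- A bounded piece of a Lipschitz graph has finite `d`-dimensional measure. -/
theorem hausdorffMeasure_graph_lt_top {ν : Sp d} (hν : ‖ν‖ = 1) {γ : Sp d → ℝ} {L : ℝ≥0}
    (hγ : LipschitzWith L γ) (R : ℝ) :
    Measure.hausdorffMeasure (d : ℝ)
      ({y : Sp d | γ (y - inner ℝ ν y • ν) = inner ℝ ν y} ∩ Metric.closedBall 0 R) < ⊤ := by
  have hν0 : ν ≠ 0 := by
    rintro rfl
    simp at hν
  let W : Submodule ℝ (Sp d) := (ℝ ∙ ν)ᗮ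
  have : Fact (Module.finrank ℝ (Sp d) = d + 1) := ⟨by simp⟩
  have hW : Module.finrank ℝ W = d := Submodule.finrank_orthogonal_span_singleton hν0
  -- The graph is parametrized over the `d`-dimensional hyperplane orthogonal to ν. A Lipschitz
  -- image of a ball of that hyperplane has finite `d`-dimensional measure.
  let F : W → Sp d := fun w => (w : Sp d) + γ w • ν
  have hF : LipschitzWith (1 + L) F := by
    refine LipschitzWith.add W.subtypeₗᵢ.lipschitz ?_
    refine LipschitzWith.of_dist_le_mul fun a b => ?_
    rw [dist_eq_norm, ← sub_smul, norm_smul, hν, mul_one, ← dist_eq_norm]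
    exact hγ.dist_le_mul _ _
  have hsub : {y : Sp d | γ (y - inner ℝ ν y • ν) = inner ℝ ν y} ∩ Metric.closedBall 0 R
      ⊆ F '' Metric.closedBall 0 R := by
    rintro y ⟨hy, hyR⟩
    have hin : inner ℝ ν (y - inner ℝ ν y • ν) = 0 := by
      rw [inner_sub_right, inner_smul_right, real_inner_self_eq_norm_sq, hν]
      ring
    refine ⟨⟨y - inner ℝ ν y • ν, Submodule.mem_orthogonal_singleton_iff_inner_right.2 hin⟩, ?_, ?_⟩
    -- Orthogonal projection does not increase the norm, so the parameter stays in the ball of the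
    -- same radius.
    · rw [mem_closedBall_zero_iff] at hyR ⊢
      refine le_trans ?_ hyR
      have h2 : ‖y - inner ℝ ν y • ν‖ ^ 2 = ‖y‖ ^ 2 - (inner ℝ ν y) ^ 2 := by
        rw [norm_sub_sq_real, norm_smul, hν, inner_smul_right, real_inner_comm, Real.norm_eq_abs,
          mul_one, sq_abs]
        ring
      refine le_of_sq_le_sq ?_ (norm_nonneg y)
      change ‖y - inner ℝ ν y • ν‖ ^ 2 ≤ _
      rw [h2]
      nlinarith [sq_nonneg (inner ℝ ν y)]
    · change y - inner ℝ ν y • ν + γ (y - inner ℝ ν y • ν) • ν = y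
      rw [Set.mem_ofPred_eq] at hy
      rw [hy, sub_add_cancel]
  refine (measure_mono hsub).trans_lt
    ((hF.hausdorffMeasure_image_le (Nat.cast_nonneg d) _).trans_lt ?_)
  have hfin : Measure.hausdorffMeasure (d : ℝ) (Metric.closedBall (0 : W) R) < ⊤ := by
    have := (isCompact_closedBall (0 : W) R).measure_lt_top
      (μ := Measure.hausdorffMeasure (Module.finrank ℝ W : ℝ))
    rwa [hW] at this
  exact ENNReal.mul_lt_top (ENNReal.rpow_lt_top_of_nonneg (Nat.cast_nonneg d) ENNReal.coe_ne_top)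
    hfin

/-- By compactness of the frontier a local bound suffices. Near a boundary point the frontier lies
on the graph of γ: closure points satisfy γ ≤ height, and points strictly above the graph are
interior. -/
theorem IsLipschitzDomain.hausdorffMeasure_frontier_lt_top {A : Set (Sp d)}
    (hA : IsLipschitzDomain A) :
    Measure.hausdorffMeasure (d : ℝ) (frontier A) < ⊤ := by
  have hc : IsCompact (frontier A) :=
    Metric.isCompact_of_isClosed_isBounded isClosed_frontier
      (hA.isBounded.closure.subset frontier_subset_closure)
  refine hc.measure_lt_top_of_nhdsWithin fun x hx => ?_
  obtain ⟨ν, γ, L, r, hν, hγ, hr, h⟩ := hA.boundary x hx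
  refine ⟨frontier A ∩ Metric.ball x r,
    inter_mem self_mem_nhdsWithin (mem_nhdsWithin_of_mem_nhds (Metric.ball_mem_nhds x hr)),
    (measure_mono ?_).trans_lt (hausdorffMeasure_graph_lt_top hν hγ (‖x‖ + r))⟩
  rintro y ⟨hyA, hyr⟩
  have hp : Continuous fun z : Sp d => γ (z - inner ℝ ν z • ν) :=
    hγ.continuous.comp (by fun_prop)
  have hi : Continuous fun z : Sp d => inner ℝ ν z := by fun_prop
  refine ⟨le_antisymm ?_ ?_, ?_⟩
  · have hy : y ∈ closure (A ∩ Metric.ball x r) :=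
      Metric.isOpen_ball.closure_inter ⟨frontier_subset_closure hyA, hyr⟩
    rw [h] at hy
    exact closure_minimal (fun z hz => le_of_lt hz.1) (isClosed_le hp hi) hy
  · by_contra hlt
    have : y ∈ A ∩ Metric.ball x r := by
      rw [h]
      exact ⟨not_le.1 hlt, hyr⟩
    rw [hA.isOpen.frontier_eq] at hyA
    exact hyA.2 this.1
  · rw [mem_closedBall_zero_iff]
    rw [Metric.mem_ball, dist_eq_norm] at hyr
    have := norm_le_norm_add_norm_sub' y x
    linarith

/-- A point of M ∩ Ω away from the closures of both subdomains would have a neighbourhood contained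
in M. The local defining function would vanish there, contradicting its nonzero gradient. -/
theorem IsDivided.subset_frontier {Ω Ωp Ωm M : Set (Sp d)} (h : IsDivided Ω Ωp Ωm M) :
    M ∩ Ω ⊆ frontier Ωp ∪ frontier Ωm := by
  intro x hx
  have hxn : x ∉ Ωp ∪ Ωm := by
    rw [h.union_eq]
    exact fun h' => h'.2 hx.1
  have hcl : x ∈ closure (Ωp ∪ Ωm) := by
    by_contra hcl
    obtain ⟨U, f, hU, hxU, -, hg, hMU⟩ := h.hypersurface x hx
    apply hg
    have hev : f =ᶠ[𝓝 x] fun _ => (0 : ℝ) := by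
      filter_upwards [hU.mem_nhds hxU, h.domain.isOpen.mem_nhds hx.2,
        isClosed_closure.isOpen_compl.mem_nhds hcl] with y hyU hyΩ hy
      have hyM : y ∈ M := by
        by_contra hyM
        exact hy (subset_closure (h.union_eq ▸ ⟨hyΩ, hyM⟩))
      have : y ∈ M ∩ U := ⟨hyM, hyU⟩
      rw [hMU] at this
      exact this.2
    rw [hev.gradient_eq, gradient_fun_const]
  rw [closure_union] at hcl
  rw [h.domain_plus.isOpen.frontier_eq, h.domain_minus.isOpen.frontier_eq]
  rcases hcl with hcl | hcl
  · exact Or.inl ⟨hcl, fun h' => hxn (Or.inl h')⟩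
  · exact Or.inr ⟨hcl, fun h' => hxn (Or.inr h')⟩

theorem IsDivided.isFiniteMeasure_surf {Ω Ωp Ωm M : Set (Sp d)} (h : IsDivided Ω Ωp Ωm M) :
    IsFiniteMeasure (surf Ω M) := by
  refine ⟨?_⟩
  rw [surf, Measure.restrict_apply_univ, Measure.euclideanHausdorffMeasure_def, Measure.smul_apply,
    ENNReal.smul_def, smul_eq_mul]
  refine ENNReal.mul_lt_top ENNReal.coe_lt_top ((measure_mono h.subset_frontier).trans_lt ?_)
  exact (measure_union_le _ _).trans_lt (ENNReal.add_lt_top.2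
    ⟨h.domain_plus.hausdorffMeasure_frontier_lt_top,
      h.domain_minus.hausdorffMeasure_frontier_lt_top⟩)

/-! ### Square integrable functions -/

section L2

variable {α F : Type*} [MeasurableSpace α] {μ : Measure α}
  [NormedAddCommGroup F] [InnerProductSpace ℝ F]

theorem integrable_inner_of_memLp {f g : α → F} (hf : MemLp f 2 μ) (hg : MemLp g 2 μ) :
    Integrable (fun x => inner ℝ (f x) (g x)) μ := by
  refine (L2.integrable_inner (𝕜 := ℝ) (hf.toLp f) (hg.toLp g)).congr ?_
  filter_upwards [hf.coeFn_toLp, hg.coeFn_toLp] with x hx hy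
  rw [hx, hy]

theorem abs_integral_inner_le {f g : α → F} (hf : MemLp f 2 μ) (hg : MemLp g 2 μ) :
    |∫ x, inner ℝ (f x) (g x) ∂μ| ≤ (eLpNorm f 2 μ).toReal * (eLpNorm g 2 μ).toReal := by
  have h : ∫ x, inner ℝ (f x) (g x) ∂μ = inner ℝ (hf.toLp f) (hg.toLp g) := by
    rw [L2.inner_def]
    refine integral_congr_ae ?_
    filter_upwards [hf.coeFn_toLp, hg.coeFn_toLp] with x hx hy
    rw [hx, hy]
  rw [h, ← Lp.norm_toLp f hf, ← Lp.norm_toLp g hg]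
  exact abs_real_inner_le_norm _ _

theorem integral_norm_sq_eq {f : α → F} (hf : MemLp f 2 μ) :
    ∫ x, ‖f x‖ ^ 2 ∂μ = (eLpNorm f 2 μ).toReal ^ 2 := by
  rw [← Lp.norm_toLp f hf, ← real_inner_self_eq_norm_sq, L2.inner_def]
  refine integral_congr_ae ?_
  filter_upwards [hf.coeFn_toLp] with x hx
  rw [hx, real_inner_self_eq_norm_sq]

theorem integrable_mul_of_memLp {f g : α → ℝ} (hf : MemLp f 2 μ) (hg : MemLp g 2 μ) :
    Integrable (fun x => f x * g x) μ :=
  hf.integrable_mul hg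

theorem integrable_smul_of_memLp {f : α → ℝ} {g : α → F} (hf : MemLp f 2 μ) (hg : MemLp g 2 μ) :
    Integrable (fun x => f x • g x) μ :=
  memLp_one_iff_integrable.1 (hg.smul hf)

theorem abs_integral_mul_le {f g : α → ℝ} (hf : MemLp f 2 μ) (hg : MemLp g 2 μ) :
    |∫ x, f x * g x ∂μ| ≤ (eLpNorm f 2 μ).toReal * (eLpNorm g 2 μ).toReal := by
  have := abs_integral_inner_le hg hf
  simp only [RCLike.inner_apply, conj_trivial] at this
  rw [mul_comm (eLpNorm f 2 μ).toReal]
  exact this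

/-- Cauchy-Schwarz bounds the difference of the integrals by ‖h‖ ‖s k - f‖. -/
theorem tendsto_integral_inner {h f : α → F} {s : ℕ → α → F} (hh : MemLp h 2 μ)
    (hf : MemLp f 2 μ) (hs : ∀ k, MemLp (s k) 2 μ)
    (hlim : Tendsto (fun k => eLpNorm (fun x => s k x - f x) 2 μ) atTop (𝓝 0)) :
    Tendsto (fun k => ∫ x, inner ℝ (h x) (s k x) ∂μ) atTop (𝓝 (∫ x, inner ℝ (h x) (f x) ∂μ)) := by
  rw [tendsto_iff_norm_sub_tendsto_zero]
  have hlim' : Tendsto (fun k => (eLpNorm h 2 μ).toReal *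
      (eLpNorm (fun x => s k x - f x) 2 μ).toReal) atTop (𝓝 0) := by
    have := ((ENNReal.tendsto_toReal ENNReal.zero_ne_top).comp hlim).const_mul
      (eLpNorm h 2 μ).toReal
    simpa using this
  refine squeeze_zero (fun _ => norm_nonneg _) (fun k => ?_) hlim'
  rw [← integral_sub (integrable_inner_of_memLp hh (hs k)) (integrable_inner_of_memLp hh hf)]
  simp_rw [← inner_sub_right]
  exact abs_integral_inner_le hh ((hs k).sub hf)

theorem tendsto_integral_mul {h f : α → ℝ} {s : ℕ → α → ℝ} (hh : MemLp h 2 μ)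
    (hf : MemLp f 2 μ) (hs : ∀ k, MemLp (s k) 2 μ)
    (hlim : Tendsto (fun k => eLpNorm (fun x => s k x - f x) 2 μ) atTop (𝓝 0)) :
    Tendsto (fun k => ∫ x, h x * s k x ∂μ) atTop (𝓝 (∫ x, h x * f x ∂μ)) := by
  have := tendsto_integral_inner hh hf hs hlim
  simpa only [RCLike.inner_apply, conj_trivial, mul_comm] using this

theorem tendsto_eLpNorm_linComb {f g : α → F} {s t : ℕ → α → F} (a b : ℝ)
    (hf : MemLp f 2 μ) (hg : MemLp g 2 μ) (hs : ∀ k, MemLp (s k) 2 μ) (ht : ∀ k, MemLp (t k) 2 μ)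
    (hsf : Tendsto (fun k => eLpNorm (fun x => s k x - f x) 2 μ) atTop (𝓝 0))
    (htg : Tendsto (fun k => eLpNorm (fun x => t k x - g x) 2 μ) atTop (𝓝 0)) :
    Tendsto (fun k => eLpNorm (fun x => (a • s k x + b • t k x) - (a • f x + b • g x)) 2 μ)
      atTop (𝓝 0) := by
  have hlim : Tendsto (fun k => ‖a‖ₑ * eLpNorm (fun x => s k x - f x) 2 μ
      + ‖b‖ₑ * eLpNorm (fun x => t k x - g x) 2 μ) atTop (𝓝 0) := by
    have h1 := ENNReal.Tendsto.const_mul (a := ‖a‖ₑ) hsf (Or.inr enorm_ne_top)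
    have h2 := ENNReal.Tendsto.const_mul (a := ‖b‖ₑ) htg (Or.inr enorm_ne_top)
    simpa using h1.add h2
  refine tendsto_of_tendsto_of_tendsto_of_le_of_le tendsto_const_nhds hlim
    (fun _ => zero_le) fun k => ?_
  have hfun : (fun x => (a • s k x + b • t k x) - (a • f x + b • g x))
      = a • (fun x => s k x - f x) + b • (fun x => t k x - g x) := by
    funext x
    simp only [Pi.add_apply, Pi.smul_apply, smul_sub]
    abel
  dsimp only
  rw [hfun, ← eLpNorm_const_smul, ← eLpNorm_const_smul]
  exact eLpNorm_add_le ((((hs k).sub hf).const_smul a).aestronglyMeasurable)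
    ((((ht k).sub hg).const_smul b).aestronglyMeasurable) one_le_two

end L2

/-! ### Test functions -/

theorem IsTest.mono {A B : Set (Sp d)} {f : Sp d → ℝ} (hf : IsTest A f) (h : A ⊆ B) : IsTest B f :=
  ⟨hf.1, hf.2.1, hf.2.2.trans h⟩

theorem IsTest.univ {A : Set (Sp d)} {f : Sp d → ℝ} (hf : IsTest A f) : IsTest Set.univ f :=
  hf.mono (Set.subset_univ A)

theorem IsTest.linComb {A : Set (Sp d)} {f g : Sp d → ℝ} (hf : IsTest A f) (hg : IsTest A g)
    (a b : ℝ) : IsTest A (fun x => a • f x + b • g x) := by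
  have h : tsupport (fun x => a • f x + b • g x) ⊆ tsupport f ∪ tsupport g := by
    refine closure_minimal (fun x hx => ?_) ((isClosed_tsupport f).union (isClosed_tsupport g))
    by_contra hn
    rw [Set.mem_union, not_or] at hn
    apply hx
    simp [image_eq_zero_of_notMem_tsupport hn.1, image_eq_zero_of_notMem_tsupport hn.2]
  exact ⟨(hf.1.const_smul a).add (hg.1.const_smul b),
    (hf.2.1.isCompact.union hg.2.1.isCompact).of_isClosed_subset (isClosed_tsupport _) h,
    h.trans (Set.union_subset hf.2.2 hg.2.2)⟩

theorem gradient_linComb {f g : Sp d → ℝ} {x : Sp d} (hf : DifferentiableAt ℝ f x)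
    (hg : DifferentiableAt ℝ g x) (a b : ℝ) :
    gradient (fun y => a • f y + b • g y) x = a • gradient f x + b • gradient g x := by
  refine ext_inner_right ℝ fun v => ?_
  rw [inner_add_left, inner_smul_left, inner_smul_left, inner_gradient_left, inner_gradient_left,
    inner_gradient_left]
  have := ((hf.hasFDerivAt.const_smul a).add (hg.hasFDerivAt.const_smul b)).fderiv
  change fderiv ℝ (fun y => a • f y + b • g y) x = _ at this
  rw [this]
  simp

theorem IsTest.differentiable {A : Set (Sp d)} {f : Sp d → ℝ} (hf : IsTest A f) :
    Differentiable ℝ f :=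
  hf.1.differentiable (by simp)

theorem IsTest.continuous_gradient {A : Set (Sp d)} {f : Sp d → ℝ} (hf : IsTest A f) :
    Continuous (gradient f) :=
  (InnerProductSpace.toDual ℝ (Sp d)).symm.continuous.comp (hf.1.continuous_fderiv (by simp))

theorem IsTest.hasCompactSupport_gradient {A : Set (Sp d)} {f : Sp d → ℝ} (hf : IsTest A f) :
    HasCompactSupport (gradient f) :=
  (hf.2.1.fderiv ℝ).comp_left (g := (InnerProductSpace.toDual ℝ (Sp d)).symm) (map_zero _)

theorem IsTest.gradient_eq_zero {A : Set (Sp d)} {f : Sp d → ℝ} (hf : IsTest A f) {x : Sp d}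
    (hx : x ∉ A) : gradient f x = 0 := by
  have h : fderiv ℝ f x = 0 := by
    by_contra h
    exact hx (hf.2.2 (support_fderiv_subset ℝ h))
  rw [gradient, h, map_zero]

theorem IsTest.memLp {A : Set (Sp d)} {f : Sp d → ℝ} (hf : IsTest A f) (μ : Measure (Sp d))
    [IsFiniteMeasureOnCompacts μ] : MemLp f 2 μ :=
  hf.1.continuous.memLp_of_hasCompactSupport hf.2.1

theorem IsTest.memLp_gradient {A : Set (Sp d)} {f : Sp d → ℝ} (hf : IsTest A f)
    (μ : Measure (Sp d)) [IsFiniteMeasureOnCompacts μ] : MemLp (gradient f) 2 μ :=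
  hf.continuous_gradient.memLp_of_hasCompactSupport hf.hasCompactSupport_gradient

/-- The support of f may cross ∂Ω, but φ kills both integrands outside Ω. So this is integration by
parts on the whole space, done one direction v at a time. -/
theorem IsTest.integral_smul_gradient {A Ω : Set (Sp d)} {f φ : Sp d → ℝ} (hf : IsTest A f)
    (hφ : IsTest Ω φ) :
    ∫ x in Ω, f x • gradient φ x = - ∫ x in Ω, φ x • gradient f x := by
  have hφ0 : ∀ x, x ∉ Ω → φ x = 0 := fun x hx =>
    image_eq_zero_of_notMem_tsupport fun h => hx (hφ.2.2 h)
  rw [setIntegral_eq_integral_of_forall_compl_eq_zero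
      fun x hx => by rw [hφ.gradient_eq_zero hx, smul_zero],
    setIntegral_eq_integral_of_forall_compl_eq_zero fun x hx => by rw [hφ0 x hx, zero_smul]]
  have hi1 : Integrable (fun x => f x • gradient φ x) :=
    integrable_smul_of_memLp (hf.memLp volume) (hφ.memLp_gradient volume)
  have hi2 : Integrable (fun x => φ x • gradient f x) :=
    integrable_smul_of_memLp (hφ.memLp volume) (hf.memLp_gradient volume)
  refine ext_inner_left ℝ fun v => ?_
  rw [inner_neg_right, ← integral_inner hi1, ← integral_inner hi2]
  simp only [inner_smul_right, inner_gradient_right, conj_trivial]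
  have hj1 := hi1.const_inner (𝕜 := ℝ) v
  have hj2 := hi2.const_inner (𝕜 := ℝ) v
  simp only [inner_smul_right, inner_gradient_right, conj_trivial] at hj1 hj2
  rw [integral_mul_fderiv_eq_neg_fderiv_mul_of_integrable (by simpa only [mul_comm] using hj2) hj1
    (integrable_mul_of_memLp (hf.memLp volume) (hφ.memLp volume))
    (fun x _ => hf.differentiable x) (fun x _ => hφ.differentiable x)]
  simp only [mul_comm]

/-! ### Linear structure of the Sobolev space -/

/-- The linear combination `a v + b w` in `H¹(Ω)`. -/
def H1.linComb {Ω : Set (Sp d)} (a b : ℝ) (v w : H1 Ω) : H1 Ω where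
  toFun x := a • v.toFun x + b • w.toFun x
  grad x := a • v.grad x + b • w.grad x
  memLp_toFun := (v.memLp_toFun.const_smul a).add (w.memLp_toFun.const_smul b)
  memLp_grad := (v.memLp_grad.const_smul a).add (w.memLp_grad.const_smul b)
  weak_grad φ hφ := by
    have hg := hφ.memLp_gradient (volume.restrict Ω)
    have hf := hφ.memLp (volume.restrict Ω)
    have e1 : ∀ x, (a • v.toFun x + b • w.toFun x) • gradient φ x
        = a • (v.toFun x • gradient φ x) + b • (w.toFun x • gradient φ x) := fun x => by
      rw [add_smul, smul_assoc, smul_assoc]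
    have e2 : ∀ x, φ x • (a • v.grad x + b • w.grad x)
        = a • (φ x • v.grad x) + b • (φ x • w.grad x) := fun x => by
      rw [smul_add, smul_comm, smul_comm (φ x) b]
    simp only [e1, e2]
    have i1 : Integrable (fun x => v.toFun x • gradient φ x) (volume.restrict Ω) :=
      integrable_smul_of_memLp v.memLp_toFun hg
    have i2 : Integrable (fun x => w.toFun x • gradient φ x) (volume.restrict Ω) :=
      integrable_smul_of_memLp w.memLp_toFun hg
    have i3 : Integrable (fun x => φ x • v.grad x) (volume.restrict Ω) :=
      integrable_smul_of_memLp hf v.memLp_grad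
    have i4 : Integrable (fun x => φ x • w.grad x) (volume.restrict Ω) :=
      integrable_smul_of_memLp hf w.memLp_grad
    rw [integral_add (i1.fun_smul a) (i2.fun_smul b), integral_add (i3.fun_smul a) (i4.fun_smul b),
      integral_smul, integral_smul, integral_smul, integral_smul, v.weak_grad φ hφ,
      w.weak_grad φ hφ, smul_neg, smul_neg, neg_add]

/-- A smooth compactly supported function as an element of `H¹(Ω)`. -/
def H1.ofTest {A : Set (Sp d)} (Ω : Set (Sp d)) (f : Sp d → ℝ) (hf : IsTest A f) : H1 Ω where
  toFun := f
  grad := gradient f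
  memLp_toFun := hf.memLp _
  memLp_grad := hf.memLp_gradient _
  weak_grad _ hφ := hf.integral_smul_gradient hφ

variable {Ω M : Set (Sp d)}

theorem TendstoH1.linComb {f g : ℕ → Sp d → ℝ} {v w : H1 Ω} {A : Set (Sp d)}
    (hf : ∀ k, IsTest A (f k)) (hg : ∀ k, IsTest A (g k)) (hfv : TendstoH1 f v)
    (hgw : TendstoH1 g w) (a b : ℝ) :
    TendstoH1 (fun k x => a • f k x + b • g k x) (H1.linComb a b v w) := by
  refine ⟨tendsto_eLpNorm_linComb a b v.memLp_toFun w.memLp_toFun (fun k => (hf k).memLp _)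
    (fun k => (hg k).memLp _) hfv.1 hgw.1, ?_⟩
  have := tendsto_eLpNorm_linComb a b v.memLp_grad w.memLp_grad
    (fun k => (hf k).memLp_gradient _) (fun k => (hg k).memLp_gradient _) hfv.2 hgw.2
  simp only [gradient_linComb ((hf _).differentiable _) ((hg _).differentiable _)]
  exact this

theorem tendstoH1_ofTest {A : Set (Sp d)} {f : Sp d → ℝ} (hf : IsTest A f) :
    TendstoH1 (fun _ => f) (H1.ofTest Ω f hf) := by
  constructor <;> simp [H1.ofTest, nrm]

theorem MemH10.linComb {v w : H1 Ω} (hv : MemH10 v) (hw : MemH10 w) (a b : ℝ) :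
    MemH10 (H1.linComb a b v w) := by
  obtain ⟨f, hf, hfv⟩ := hv
  obtain ⟨g, hg, hgw⟩ := hw
  exact ⟨_, fun k => (hf k).linComb (hg k) a b, hfv.linComb hf hg hgw a b⟩

theorem memH10_ofTest {f : Sp d → ℝ} (hf : IsTest Ω f) : MemH10 (H1.ofTest Ω f hf) :=
  ⟨fun _ => f, fun _ => hf, tendstoH1_ofTest hf⟩

theorem IsTrace.linComb [IsFiniteMeasure (surf Ω M)] {v w : H1 Ω} {g h : Sp d → ℝ}
    (hv : IsTrace M v g) (hw : IsTrace M w h) (a b : ℝ) :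
    IsTrace M (H1.linComb a b v w) (fun x => a • g x + b • h x) := by
  obtain ⟨hg, f, hf, hfv, hfg⟩ := hv
  obtain ⟨hh, k, hk, hkw, hkh⟩ := hw
  exact ⟨(hg.const_smul a).add (hh.const_smul b), _, fun n => (hf n).linComb (hk n) a b,
    hfv.linComb hf hk hkw a b, tendsto_eLpNorm_linComb a b hg hh (fun n => (hf n).memLp _)
      (fun n => (hk n).memLp _) hfg hkh⟩

theorem isTrace_ofTest [IsFiniteMeasure (surf Ω M)] {A : Set (Sp d)} {f : Sp d → ℝ}
    (hf : IsTest A f) : IsTrace M (H1.ofTest Ω f hf) f :=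
  ⟨hf.memLp _, fun _ => f, fun _ => hf.univ, tendstoH1_ofTest hf, by simp [nrmM]⟩

/-- The weak gradient is unique. -/
theorem H1.grad_ae_eq (hΩ : IsOpen Ω) {v w : H1 Ω}
    (h : v.toFun =ᵐ[volume.restrict Ω] w.toFun) : v.grad =ᵐ[volume.restrict Ω] w.grad := by
  have hloc : LocallyIntegrableOn (fun x => v.grad x - w.grad x) Ω := by
    have : LocallyIntegrable (fun x => v.grad x - w.grad x) (volume.restrict Ω) :=
      (v.memLp_grad.sub w.memLp_grad).locallyIntegrable one_le_two
    exact locallyIntegrableOn_of_locallyIntegrable_restrict this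
  have key := hΩ.ae_eq_zero_of_integral_contDiff_smul_eq_zero hloc fun φ hφ hc hs => by
    have ht : IsTest Ω φ := ⟨hφ, hc, hs⟩
    have hφ0 : ∀ x, x ∉ Ω → φ x = 0 := fun x hx =>
      image_eq_zero_of_notMem_tsupport fun h => hx (hs h)
    rw [← setIntegral_eq_integral_of_forall_compl_eq_zero (s := Ω)
      fun x hx => by rw [hφ0 x hx, zero_smul]]
    have i1 : Integrable (fun x => φ x • v.grad x) (volume.restrict Ω) :=
      integrable_smul_of_memLp (ht.memLp _) v.memLp_grad
    have i2 : Integrable (fun x => φ x • w.grad x) (volume.restrict Ω) :=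
      integrable_smul_of_memLp (ht.memLp _) w.memLp_grad
    simp only [smul_sub]
    rw [integral_sub i1 i2, sub_eq_zero, ← neg_inj, ← v.weak_grad φ ht, ← w.weak_grad φ ht]
    refine integral_congr_ae ?_
    filter_upwards [h] with x hx
    rw [hx]
  rw [Filter.EventuallyEq, ae_restrict_iff' hΩ.measurableSet]
  filter_upwards [key] with x hx hxΩ
  exact sub_eq_zero.1 (hx hxΩ)

/-- 𝕂 prescribes the boundary datum through function values only; uniqueness of the weak gradient
transfers the convergence of gradients. -/
theorem MemH10.congr (hΩ : IsOpen Ω) {v w : H1 Ω} (hv : MemH10 v)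
    (h : v.toFun =ᵐ[volume.restrict Ω] w.toFun) : MemH10 w := by
  obtain ⟨f, hf, h1, h2⟩ := hv
  refine ⟨f, hf, h1.congr fun k => eLpNorm_congr_ae ?_, h2.congr fun k => eLpNorm_congr_ae ?_⟩
  · filter_upwards [h] with x hx
    rw [hx]
  · filter_upwards [H1.grad_ae_eq hΩ h] with x hx
    rw [hx]

/-! ### The Gauss-Green formula on `H¹₀(Ω)` -/

/-- Test functions converging to `w ∈ H¹₀(Ω)` also converge on `M` to any trace of `w`. -/
theorem tendsto_trace [IsFiniteMeasure (surf Ω M)] {A : Set (Sp d)} (hA : A ⊆ Ω) {C : ℝ≥0}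
    (hC : IsTraceConst Ω M A C) {w : H1 Ω} {g : Sp d → ℝ} (hg : IsTrace M w g) (hw : MemH10 w)
    {f : ℕ → Sp d → ℝ} (hf : ∀ k, IsTest Ω (f k)) (hfw : TendstoH1 f w) :
    Tendsto (fun k => eLpNorm (fun x => f k x - g x) 2 (surf Ω M)) atTop (𝓝 0) := by
  have hlim : Tendsto (fun k => (C : ℝ≥0∞) * nrm Ω (fun x => gradient (f k) x - w.grad x)) atTop
      (𝓝 0) := by
    simpa using ENNReal.Tendsto.const_mul (a := (C : ℝ≥0∞)) hfw.2 (Or.inr ENNReal.coe_ne_top)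
  refine tendsto_of_tendsto_of_tendsto_of_le_of_le tendsto_const_nhds hlim
    (fun _ => zero_le) fun k => ?_
  -- The sequence witnessing `IsTrace` need not be f. The trace inequality for f k - w, whose trace
  -- is f k - g, links the two.
  have h := hC (H1.linComb (-1) 1 w (H1.ofTest Ω (f k) (hf k)))
    (hw.linComb (memH10_ofTest (hf k)) _ _) _ (hg.linComb (isTrace_ofTest (hf k)) _ _)
  simp only [H1.linComb, H1.ofTest, nrmM, neg_smul, one_smul, neg_add_eq_sub] at h
  refine h.trans ?_
  gcongr
  exact eLpNorm_mono_measure _ (Measure.restrict_mono hA le_rfl)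

/-- Density: each term of `weak_jump` passes to the limit along test functions tending to w, the
surface term by `tendsto_trace`. -/
theorem HDiv.integral_inner_grad {Ωp Ωm : Set (Sp d)} [IsFiniteMeasure (surf Ω M)]
    (hp : Ωp ⊆ Ω) (hm : Ωm ⊆ Ω) (q : HDiv Ω Ωp Ωm M) {A : Set (Sp d)} (hA : A ⊆ Ω) {C : ℝ≥0}
    (hC : IsTraceConst Ω M A C) {w : H1 Ω} {g : Sp d → ℝ} (hg : IsTrace M w g) (hw : MemH10 w) :
    (∫ x in Ω, inner ℝ (q.toFun x) (w.grad x))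
      + (∫ x in Ωp, q.div x * w.toFun x) + (∫ x in Ωm, q.div x * w.toFun x)
      = ∫ x, q.jump x * g x ∂(surf Ω M) := by
  obtain ⟨f, hf, hfw⟩ := id hw
  have hsub : ∀ B ⊆ Ω, Tendsto (fun k => eLpNorm (fun x => f k x - w.toFun x) 2
      (volume.restrict B)) atTop (𝓝 0) := fun B hB =>
    tendsto_of_tendsto_of_tendsto_of_le_of_le tendsto_const_nhds hfw.1 (fun _ => zero_le)
      fun k => eLpNorm_mono_measure _ (Measure.restrict_mono hB le_rfl)
  have h1 := tendsto_integral_inner q.memLp_toFun w.memLp_grad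
    (fun k => (hf k).memLp_gradient _) hfw.2
  have h2 := tendsto_integral_mul q.memLp_div_plus
    (w.memLp_toFun.mono_measure (Measure.restrict_mono hp le_rfl))
    (fun k => (hf k).memLp _) (hsub Ωp hp)
  have h3 := tendsto_integral_mul q.memLp_div_minus
    (w.memLp_toFun.mono_measure (Measure.restrict_mono hm le_rfl))
    (fun k => (hf k).memLp _) (hsub Ωm hm)
  have h4 := tendsto_integral_mul q.memLp_jump hg.1 (fun k => (hf k).memLp _)
    (tendsto_trace hA hC hg hw hf hfw)
  refine tendsto_nhds_unique ((h1.add h2).add h3) (h4.congr fun k => ?_)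
  exact (q.weak_jump (f k) (hf k)).symm

/-! ### The variational inequality -/

/-- Convexity of 𝕂; a + b = 1 recovers both the datum φ and the obstacle ψ. -/
theorem linComb_mem_K [IsFiniteMeasure (surf Ω M)] {φ : H1 Ω} {ψ : Sp d → ℝ} {u v : H1 Ω}
    (hu : u ∈ K M φ ψ) (hv : v ∈ K M φ ψ) {a b : ℝ} (ha : 0 ≤ a) (hb : 0 ≤ b) (hab : a + b = 1) :
    H1.linComb a b u v ∈ K M φ ψ := by
  obtain ⟨⟨w, hw, huw⟩, g, hg, hgψ⟩ := hu
  obtain ⟨⟨z, hz, hvz⟩, h, hh, hhψ⟩ := hv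
  refine ⟨⟨H1.linComb a b w z, hw.linComb hz a b, ?_⟩, _, hg.linComb hh a b, ?_⟩
  · filter_upwards [huw, hvz] with x hx hy
    simp only [H1.linComb, hx, hy, smul_eq_mul]
    linear_combination φ.toFun x * hab
  · filter_upwards [hgψ, hhψ] with x hx hy
    have hx' := mul_le_mul_of_nonneg_left hx ha
    have hy' := mul_le_mul_of_nonneg_left hy hb
    have : a * ψ x + b * ψ x = ψ x := by rw [← add_mul, hab, one_mul]
    simp only [smul_eq_mul]
    linarith

theorem nonneg_of_forall_quadratic {I N : ℝ} (hN : 0 ≤ N)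
    (h : ∀ t : ℝ, 0 < t → t ≤ 1 → 0 ≤ 2 * t * I + t ^ 2 * N) : 0 ≤ I := by
  by_contra! hI
  -- For t = min 1 (-I / (N + 1)) one has t N ≤ -I - t, hence 2 I + t N ≤ I - t < 0, contrary to the
  -- hypothesis divided by t.
  have hd : 0 < -I / (N + 1) := by apply div_pos <;> linarith
  have ht : 0 < min 1 (-I / (N + 1)) := lt_min one_pos hd
  have h1 := h _ ht (min_le_left _ _)
  have h2 : min 1 (-I / (N + 1)) * (N + 1) ≤ -I := by
    rw [← le_div_iff₀ (by linarith)]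
    exact min_le_right _ _
  set t := min 1 (-I / (N + 1))
  have h3 : 0 ≤ t * (2 * I + t * N) := by linarith
  have h4 := nonneg_of_mul_nonneg_right h3 ht
  linarith

/-- First variation: u is compared with u + t (v - u) ∈ 𝕂, along which the energy is quadratic in t.
-/
theorem integral_inner_grad_sub_nonneg [IsFiniteMeasure (surf Ω M)] {φ : H1 Ω} {ψ : Sp d → ℝ}
    {u v : H1 Ω} (hu : u ∈ K M φ ψ) (hmin : IsMinOn energy (K M φ ψ) u) (hv : v ∈ K M φ ψ) :
    0 ≤ ∫ x in Ω, inner ℝ (u.grad x) (v.grad x - u.grad x) := by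
  have hw := v.memLp_grad.sub u.memLp_grad
  refine nonneg_of_forall_quadratic (N := ∫ x in Ω, ‖v.grad x - u.grad x‖ ^ 2)
    (integral_nonneg fun x => sq_nonneg _) fun t ht ht1 => ?_
  have hK := linComb_mem_K hu hv (sub_nonneg.2 ht1) ht.le (sub_add_cancel 1 t)
  have hle : energy u ≤ energy (H1.linComb (1 - t) t u v) := hmin hK
  have hexp : ∫ x in Ω, ‖(H1.linComb (1 - t) t u v).grad x‖ ^ 2
      = (∫ x in Ω, ‖u.grad x‖ ^ 2) + (2 * t * ∫ x in Ω, inner ℝ (u.grad x) (v.grad x - u.grad x))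
        + t ^ 2 * ∫ x in Ω, ‖v.grad x - u.grad x‖ ^ 2 := by
    have i1 : Integrable (fun x => ‖u.grad x‖ ^ 2) (volume.restrict Ω) :=
      (memLp_two_iff_integrable_sq_norm u.memLp_grad.1).1 u.memLp_grad
    have i2 : Integrable (fun x => ‖v.grad x - u.grad x‖ ^ 2) (volume.restrict Ω) :=
      (memLp_two_iff_integrable_sq_norm hw.1).1 hw
    have i3 := integrable_inner_of_memLp u.memLp_grad hw
    simp only [Pi.sub_apply] at i3
    rw [← integral_const_mul, ← integral_const_mul, ← integral_add i1 (i3.const_mul _),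
      ← integral_add (i1.fun_add (i3.const_mul _)) (i2.const_mul _)]
    refine integral_congr_ae (Eventually.of_forall fun x => ?_)
    have : (H1.linComb (1 - t) t u v).grad x = u.grad x + t • (v.grad x - u.grad x) := by
      simp only [H1.linComb, smul_sub, sub_smul, one_smul]
      abel
    simp only [this, norm_add_sq_real, inner_smul_right, norm_smul, mul_pow, Real.norm_eq_abs,
      sq_abs]
    ring
  simp only [energy] at hle
  rw [hexp] at hle
  linarith

/-! ### The majorant -/

theorem integral_le_toReal_lintegral {α : Type*} [MeasurableSpace α] {μ : Measure α} {f g : α → ℝ}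
    (hf : Integrable f μ) (hfg : f ≤ᵐ[μ] g) (hg : ∫⁻ x, ENNReal.ofReal (g x) ∂μ ≠ ⊤) :
    ∫ x, f x ∂μ ≤ (∫⁻ x, ENNReal.ofReal (g x) ∂μ).toReal := by
  rw [integral_eq_lintegral_pos_part_sub_lintegral_neg_part hf]
  refine (sub_le_self _ ENNReal.toReal_nonneg).trans (ENNReal.toReal_mono hg ?_)
  exact lintegral_mono_ae (hfg.mono fun x hx => ENNReal.ofReal_le_ofReal hx)

theorem sq_add_le_young {x y β : ℝ} (hβ : 0 < β) :
    (x + y) ^ 2 ≤ (1 + β) * x ^ 2 + (1 + β⁻¹) * y ^ 2 := by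
  have h : (1 + β) * x ^ 2 + (1 + β⁻¹) * y ^ 2 - (x + y) ^ 2 = β⁻¹ * (β * x - y) ^ 2 := by
    field_simp
    ring
  have : 0 ≤ β⁻¹ * (β * x - y) ^ 2 := by positivity
  linarith

/-- With s = a + (D + T), absorbing s n ≤ (s² + n²)/2 leaves n² ≤ s² + 2 I, whence the factor 2 on
the obstacle term. Then β₁ separates a from D + T, and β₂ separates D from T. -/
theorem sq_le_of_young {n a D T I β₁ β₂ : ℝ} (hβ₁ : 0 < β₁) (hβ₂ : 0 < β₂)
    (h : n ^ 2 ≤ (a + (D + T)) * n + I) :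
    n ^ 2 ≤ (1 + β₁) * a ^ 2 + (1 + β₁⁻¹) * (1 + β₂) * D ^ 2
      + ((1 + β₁⁻¹) * (1 + β₂⁻¹) * T ^ 2 + 2 * I) := by
  have h1 : n ^ 2 ≤ (a + (D + T)) ^ 2 + 2 * I := by nlinarith [sq_nonneg (a + (D + T) - n)]
  have h2 := sq_add_le_young (x := a) (y := D + T) hβ₁
  have h3 := mul_le_mul_of_nonneg_left (sq_add_le_young (x := D) (y := T) hβ₂)
    (show 0 ≤ 1 + β₁⁻¹ by positivity)
  linarith

/-- Every subdomain bound is relaxed to the full norm ‖∇w‖ over Ω, so that this common factor can be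
pulled out of all terms. -/
theorem toReal_le_of_le_mul {A : Set (Sp d)} (hA : A ⊆ Ω) {C : ℝ≥0} {x : ℝ≥0∞} {G : Sp d → Sp d}
    (hG : MemLp G 2 (volume.restrict Ω)) (h : x ≤ C * nrm A G) :
    x.toReal ≤ C * (nrm Ω G).toReal := by
  have h' : x ≤ C * nrm Ω G :=
    h.trans (mul_le_mul_right (eLpNorm_mono_measure _ (Measure.restrict_mono hA le_rfl)) _)
  have := ENNReal.toReal_mono (ENNReal.mul_ne_top ENNReal.coe_ne_top hG.eLpNorm_ne_top) h'
  simpa [nrm] using this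

theorem grad_sub_sq_le {Ωp Ωm : Set (Sp d)} (hΩ : IsDivided Ω Ωp Ωm M)
    {φ : H1 Ω} {ψ : Sp d → ℝ} {u v : H1 Ω} (hu : u ∈ K M φ ψ)
    (hmin : IsMinOn energy (K M φ ψ) u) {CFp CFm C : ℝ≥0}
    (hCFp : IsFriedrichsConst Ω Ωp CFp) (hCFm : IsFriedrichsConst Ω Ωm CFm) {A : Set (Sp d)}
    (hA : A ⊆ Ω) (hC : IsTraceConst Ω M A C) (hv : v ∈ K M φ ψ) {vM : Sp d → ℝ}
    (hvM : IsTrace M v vM) (q : HDiv Ω Ωp Ωm M) {lam : Sp d → ℝ} (hlam : MemLambda Ω M lam)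
    (hfin : ∫⁻ x, ENNReal.ofReal (lam x * (vM x - ψ x)) ∂(surf Ω M) ≠ ⊤) :
    (nrm Ω (fun x => v.grad x - u.grad x)).toReal ^ 2 ≤
      ((nrm Ω (fun x => v.grad x - q.toFun x)).toReal
        + ((CFp * (nrm Ωp q.div).toReal + CFm * (nrm Ωm q.div).toReal)
          + C * (nrmM Ω M (fun x => lam x - q.jump x)).toReal))
        * (nrm Ω (fun x => v.grad x - u.grad x)).toReal
      + (∫⁻ x, ENNReal.ofReal (lam x * (vM x - ψ x)) ∂(surf Ω M)).toReal := by
  have := hΩ.isFiniteMeasure_surf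
  have hp : Ωp ⊆ Ω := fun x hx => (hΩ.union_eq ▸ Or.inl hx : x ∈ Ω \ M).1
  have hm : Ωm ⊆ Ω := fun x hx => (hΩ.union_eq ▸ Or.inr hx : x ∈ Ω \ M).1
  have hVI := integral_inner_grad_sub_nonneg hu hmin hv
  obtain ⟨⟨wu, hwu, huw⟩, g, hg, hgψ⟩ := hu
  obtain ⟨⟨wv, hwv, hvw⟩, -⟩ := hv
  set w : H1 Ω := H1.linComb 1 (-1) v u with hwdef
  have hwgrad : w.grad = fun x => v.grad x - u.grad x := by
    funext x
    simp [hwdef, H1.linComb, sub_eq_add_neg]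
  -- The datum φ cancels in v - u.
  have hw0 : MemH10 w := by
    refine (hwv.linComb hwu 1 (-1)).congr hΩ.domain.isOpen ?_
    filter_upwards [huw, hvw] with x hx hy
    simp only [hwdef, H1.linComb, hx, hy, smul_eq_mul]
    ring
  have hwtr : IsTrace M w (fun x => vM x - g x) := by
    have := hvM.linComb hg 1 (-1)
    simpa only [one_smul, neg_smul, ← sub_eq_add_neg] using this
  have hGG := q.integral_inner_grad hp hm hA hC hwtr hw0
  have hvq := v.memLp_grad.sub q.memLp_toFun
  have hwp := w.memLp_toFun.mono_measure (Measure.restrict_mono hp le_rfl)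
  have hwm := w.memLp_toFun.mono_measure (Measure.restrict_mono hm le_rfl)
  have hlj := hlam.1.sub q.memLp_jump
  have hsplit : ∫ x in Ω, ‖w.grad x‖ ^ 2 = (∫ x in Ω, inner ℝ (v.grad x - q.toFun x) (w.grad x))
      + (∫ x in Ω, inner ℝ (q.toFun x) (w.grad x)) - ∫ x in Ω, inner ℝ (u.grad x) (w.grad x) := by
    have i1 := integrable_inner_of_memLp hvq w.memLp_grad
    have i2 := integrable_inner_of_memLp q.memLp_toFun w.memLp_grad
    have i3 := integrable_inner_of_memLp u.memLp_grad w.memLp_grad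
    simp only [Pi.sub_apply] at i1
    rw [← integral_add i1 i2, ← integral_sub (i1.fun_add i2) i3]
    refine integral_congr_ae (Eventually.of_forall fun x => ?_)
    simp only [← inner_add_left, ← inner_sub_left, sub_add_cancel]
    rw [show v.grad x - u.grad x = w.grad x by rw [hwgrad], real_inner_self_eq_norm_sq]
  have hjump : ∫ x, q.jump x * (vM x - g x) ∂(surf Ω M)
      = (∫ x, lam x * (vM x - g x) ∂(surf Ω M))
        - ∫ x, (lam x - q.jump x) * (vM x - g x) ∂(surf Ω M) := by
    have i1 := integrable_mul_of_memLp hlam.1 hwtr.1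
    have i2 := integrable_mul_of_memLp hlj hwtr.1
    simp only [Pi.sub_apply] at i2
    rw [← integral_sub i1 i2]
    simp only [← sub_mul, sub_sub_cancel]
  -- The obstacle enters here: g, the trace of u, satisfies g ≥ ψ, so λ (vM - g) ≤ λ (vM - ψ).
  have hI := integral_le_toReal_lintegral (integrable_mul_of_memLp hlam.1 hwtr.1)
    (g := fun x => lam x * (vM x - ψ x)) (by
      filter_upwards [hlam.2, hgψ] with x hx hy
      exact mul_le_mul_of_nonneg_left (by linarith) hx) hfin
  have b1 := (le_abs_self _).trans (abs_integral_inner_le hvq w.memLp_grad)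
  have b2 := (neg_le_abs _).trans (abs_integral_mul_le q.memLp_div_plus hwp)
  have b3 := (neg_le_abs _).trans (abs_integral_mul_le q.memLp_div_minus hwm)
  have b4 := (neg_le_abs _).trans (abs_integral_mul_le hlj hwtr.1)
  have c2 := mul_le_mul_of_nonneg_left (toReal_le_of_le_mul hp w.memLp_grad (hCFp w hw0))
    (ENNReal.toReal_nonneg (a := nrm Ωp q.div))
  have c3 := mul_le_mul_of_nonneg_left (toReal_le_of_le_mul hm w.memLp_grad (hCFm w hw0))
    (ENNReal.toReal_nonneg (a := nrm Ωm q.div))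
  have c4 := mul_le_mul_of_nonneg_left (toReal_le_of_le_mul hA w.memLp_grad (hC w hw0 _ hwtr))
    (ENNReal.toReal_nonneg (a := nrmM Ω M (fun x => lam x - q.jump x)))
  rw [integral_norm_sq_eq w.memLp_grad] at hsplit
  rw [← hwgrad]
  have hVI' : 0 ≤ ∫ x in Ω, inner ℝ (u.grad x) (w.grad x) := by
    rw [hwgrad]
    exact hVI
  simp only [Pi.sub_apply] at b1 b4
  simp only [nrm, nrmM] at *
  change _ ≤ (eLpNorm (fun x => v.grad x - q.toFun x) _ _).toReal * _ at b1
  change _ ≤ (eLpNorm (fun x => lam x - q.jump x) _ _).toReal * _ at b4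
  linarith

end ThinObstacle

end

/-! ### The majorant estimate in extended nonnegative reals -/

theorem corollary2p6 {d : ℕ} (Ω Ωp Ωm M : Set (ThinObstacle.Sp d))
    (hΩ : ThinObstacle.IsDivided Ω Ωp Ωm M)
    (φ : ThinObstacle.H1 Ω) (ψ : ThinObstacle.Sp d → ℝ) (hψ : ContinuousOn ψ (M ∩ Ω))
    (u : ThinObstacle.H1 Ω) (hu : u ∈ ThinObstacle.K M φ ψ)
    (hmin : IsMinOn ThinObstacle.energy (ThinObstacle.K M φ ψ) u)
    (CFp CFm CTrp CTrm : ℝ≥0)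
    (hCFp : ThinObstacle.IsFriedrichsConst Ω Ωp CFp)
    (hCFm : ThinObstacle.IsFriedrichsConst Ω Ωm CFm)
    (hCTrp : ThinObstacle.IsTraceConst Ω M Ωp CTrp)
    (hCTrm : ThinObstacle.IsTraceConst Ω M Ωm CTrm)
    (v : ThinObstacle.H1 Ω) (hv : v ∈ ThinObstacle.K M φ ψ)
    (vM : ThinObstacle.Sp d → ℝ) (hvM : ThinObstacle.IsTrace M v vM)
    (β₁ β₂ : ℝ) (hβ₁ : 0 < β₁) (hβ₂ : 0 < β₂)
    (q : ThinObstacle.HDiv Ω Ωp Ωm M)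
    (lam : ThinObstacle.Sp d → ℝ) (hlam : ThinObstacle.MemLambda Ω M lam) :
    ThinObstacle.nrm Ω (fun x => v.grad x - u.grad x) ^ 2
      ≤ ThinObstacle.majorant₁ CFp CFm v q β₁ β₂
        + ThinObstacle.majorant₂ (min CTrp CTrm) vM q β₁ β₂ lam ψ := by
  have hp : Ωp ⊆ Ω := fun x hx => (hΩ.union_eq ▸ Or.inl hx : x ∈ Ω \ M).1
  have hm : Ωm ⊆ Ω := fun x hx => (hΩ.union_eq ▸ Or.inr hx : x ∈ Ω \ M).1
  -- The smaller trace constant belongs to one of the sides, and the estimate needs a trace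
  -- inequality from one side only.
  obtain ⟨A, hA, hC⟩ : ∃ A ⊆ Ω, ThinObstacle.IsTraceConst Ω M A (min CTrp CTrm) := by
    rcases min_choice CTrp CTrm with h | h <;> rw [h]
    exacts [⟨Ωp, hp, hCTrp⟩, ⟨Ωm, hm, hCTrm⟩]
  generalize min CTrp CTrm = C at hC ⊢
  -- An infinite obstacle integral makes the right-hand side infinite; otherwise every quantity is
  -- finite and the real estimate applies.
  by_cases hfin : ∫⁻ x, ENNReal.ofReal (lam x * (vM x - ψ x)) ∂(ThinObstacle.surf Ω M) = ⊤
  · rw [ThinObstacle.majorant₂, hfin]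
    simp
  have hreal := ThinObstacle.sq_le_of_young hβ₁ hβ₂ (ThinObstacle.grad_sub_sq_le hΩ hu hmin
    hCFp hCFm hA hC hv hvM q hlam hfin)
  have t1 : ThinObstacle.nrm Ω (fun x => v.grad x - u.grad x) ≠ ⊤ :=
    (v.memLp_grad.sub u.memLp_grad).eLpNorm_ne_top
  have t2 : ThinObstacle.nrm Ω (fun x => v.grad x - q.toFun x) ≠ ⊤ :=
    (v.memLp_grad.sub q.memLp_toFun).eLpNorm_ne_top
  have t3 : ThinObstacle.nrm Ωp q.div ≠ ⊤ := q.memLp_div_plus.eLpNorm_ne_top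
  have t4 : ThinObstacle.nrm Ωm q.div ≠ ⊤ := q.memLp_div_minus.eLpNorm_ne_top
  have t5 : ThinObstacle.nrmM Ω M (fun x => lam x - q.jump x) ≠ ⊤ :=
    (hlam.1.sub q.memLp_jump).eLpNorm_ne_top
  rw [← ENNReal.ofReal_toReal t1, ← ENNReal.ofReal_pow ENNReal.toReal_nonneg]
  refine (ENNReal.ofReal_le_ofReal hreal).trans (le_of_eq ?_)
  rw [ThinObstacle.majorant₁, ThinObstacle.majorant₂]
  lift ThinObstacle.nrm Ω (fun x => v.grad x - q.toFun x) to ℝ≥0 using t2 with n2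
  lift ThinObstacle.nrm Ωp q.div to ℝ≥0 using t3 with n3
  lift ThinObstacle.nrm Ωm q.div to ℝ≥0 using t4 with n4
  lift ThinObstacle.nrmM Ω M (fun x => lam x - q.jump x) to ℝ≥0 using t5 with n5
  lift ∫⁻ x, ENNReal.ofReal (lam x * (vM x - ψ x)) ∂(ThinObstacle.surf Ω M) to ℝ≥0
    using hfin with n6
  simp only [ENNReal.coe_toReal]
  have e1 : 0 ≤ 1 + β₁ := by positivity
  have e2 : 0 ≤ (1 + β₁⁻¹) * (1 + β₂) := by positivity
  have e3 : 0 ≤ (1 + β₁⁻¹) * (1 + β₂⁻¹) := by positivity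
  -- Only nonnegativity of the coefficients matters from here on; as opaque constants they lift to
  -- `ℝ≥0` and the casts can be normalized.
  generalize 1 + β₁ = c₁ at e1 ⊢
  generalize (1 + β₁⁻¹) * (1 + β₂) = c₂ at e2 ⊢
  generalize (1 + β₁⁻¹) * (1 + β₂⁻¹) = c₃ at e3 ⊢
  lift c₁ to ℝ≥0 using e1
  lift c₂ to ℝ≥0 using e2
  lift c₃ to ℝ≥0 using e3
  simp only [ENNReal.ofReal_coe_nnreal, mul_assoc, ← mul_pow]
  norm_cast
  exact ENNReal.ofReal_coe_nnreal
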